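/- Let $N\in\mathbb{N}$, let $p,q,a,c$ be non-zero complex numbers with $p^2\neq a^2$, $q^2\neq a^2$, and let $\mathcal A_\pm$ be non-singular complex lower triangular $N\times N$ Toeplitz matrices. For $n,m,\alpha,\beta\in\mathbb{Z}$, $l\in\mathbb{N}$ and $b\ne 0$ put $$\Phi(\alpha,\beta,l)=\mathcal A_+\Phi^+(\alpha,\beta,l)+\mathcal A_-\Phi^-(\alpha,\beta,l),\qquad \Phi^\pm=(\phi_0^\pm,\dots,\phi_{N-1}^\pm)^T,$$ $$\phi_s^\pm(\alpha,\beta,l)=\frac1{(2s)!}\partial_k^{2s}\Big[(p\pm k)^n(q\pm k)^m(a\pm k)^\alpha(b\pm k)^\beta(c\pm k)^{l+\frac12}\Big]\Big|_{k=0},$$ where $(c\pm k)^{1/2}$ denotes a branch of the square root that is holomorphic near $k=0$ (namely $c^{1/2}(1\pm k/c)^{1/2}$ with principal square roots). Let $$f=|\Phi(0,0,0),\dots,\Phi(0,0,N-1)|,\qquad S(a,b)=-\frac{(ab)^N\,|\Phi(-1,-1,0),\dots,\Phi(-1,-1,N-1)|-f}{(a+b)\,f},$$ where for $b=-a$ the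 value $S(a,-a)$ is the limit of $S(a,b')$ as $b'\to -a$; the quantities $S(-a,\cdot)$ are obtained by replacing $a$ by $-a$ with the same $p,q,c,\mathcal A_\pm$. The function $f$ depends only on $(n,m)$ (and on $p,q,c,\mathcal A_\pm$), while $S$ depends on $(n,m)$ as well. Put $$\xi=2a\Big(\frac{p}{a^2-p^2}n+\frac{q}{a^2-q^2}m\Big),\qquad \rho(a)=\Big(\frac{p+a}{p-a}\Big)^n\Big(\frac{q+a}{q-a}\Big)^m .$$ Let $A,B,D,\xi_0,\delta\in\mathbb{C}$ satisfy $AD+\tfrac14B^2=\tfrac{\delta^2}{16}$, and define $$u=A\rho(a)\big(1-2aS(a,a)\big)+B\big(\xi+\xi_0+2aS(-a,a)\big)+D\rho(-a)\big(1+2aS(-a,-a)\big).$$ (i) Write $\widetilde u=u(n+1,m)$, $\widehat u=u(n,m+1)$, $\widehat{\widetilde u}=u(n+1,m+1)$. At every $(n,m)\in\mathbb{Z}^2$ such that $f$ does not vanish at the four points $(n,m),(n+1,m),(n,m+1),(n+1,m+1)$, $u$ satisfies the lattice equation $\mathrm{Q1}_\delta$: $$(q^2-a^2)(u-\widehat u)(\widetilde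 u-\widehat{\widetilde u})-(p^2-a^2)(u-\widetilde u)(\widehat u-\widehat{\widetilde u})=\frac{\delta^2a^4(p^2-q^2)}{(p^2-a^2)(q^2-a^2)}.$$ (ii) At every $(n,m)\in\mathbb{Z}^2$ with $f(n,m)\ne0$, the functions $b\mapsto S(a,b)$ and $b\mapsto S(-a,b)$ are differentiable at $b=-a$ and $b=a$ respectively (in particular the limits above exist), and $u$ is the degeneration of the Q2 solution formula $$u_{\mathrm{Q2}}[A,D,\xi_0]=\tfrac14\big((\xi+\xi_0)^2+1\big)+a(\xi+\xi_0)S(-a,a)+a^2\big(U(a,-a)+U(-a,a)\big)+AD+\tfrac12A\rho(a)(1-2aS(a,a))+\tfrac12D\rho(-a)(1+2aS(-a,-a)),$$ $$U(a,-a)=-\tfrac1{2a}\partial_\epsilon S(a,2a\epsilon-a)\big|_{\epsilon=0},\qquad U(-a,a)=\tfrac1{2a}\partial_\epsilon S(-a,a-2a\epsilon)\big|_{\epsilon=0},$$ in the sense that $$u=\lim_{\epsilon\to0}\ \epsilon\Big(u_{\mathrm{Q2}}\big[\tfrac{2A}{\epsilon},\tfrac{2D}{\epsilon},\xi_0+\tfrac{2B}{\epsilon}\big]-\frac{\delta^2}{4\epsilon^2}\Big).$$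 -/

import Mathlib

open Filter Topology

noncomputable section

namespace RationalABS

/-- The branch `c^(1/2) * (1 + k/c)^(1/2)` of `(c + k)^(1/2)`; for every `c ≠ 0` it is holomorphic
in `k` near `k = 0`. Another choice of branch only changes the sign. -/
def halfPow (c k : ℂ) : ℂ :=
  c ^ (1 / 2 : ℂ) * (1 + k / c) ^ (1 / 2 : ℂ)

/-- `(p + σk)^n (q + σk)^m (a + σk)^α (b + σk)^β (c + σk)^(l + 1/2)`, with the sign `σ = ±1`. -/
def planeWave (p q c a b : ℂ) (α β n m : ℤ) (l : ℕ) (σ k : ℂ) : ℂ :=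
  (p + σ * k) ^ n * (q + σ * k) ^ m * (a + σ * k) ^ α * (b + σ * k) ^ β *
    ((c + σ * k) ^ l * halfPow c (σ * k))

/-- `φ_s^±(α, β, l)`: the derivative of order `2s` in `k` at `k = 0`, divided by `(2s)!`. -/
def phi (p q c a b : ℂ) (α β n m : ℤ) (l : ℕ) (σ : ℂ) (s : ℕ) : ℂ :=
  iteratedDeriv (2 * s) (planeWave p q c a b α β n m l σ) 0 / ((2 * s).factorial : ℂ)

/-- A lower triangular Toeplitz matrix. -/
def IsLowerToeplitz {N : ℕ} (M : Matrix (Fin N) (Fin N) ℂ) : Prop :=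
  ∃ t : ℕ → ℂ, ∀ i j : Fin N, M i j = if j ≤ i then t ((i : ℕ) - (j : ℕ)) else 0

section Casoratian

variable {N : ℕ} (p q c : ℂ) (Ap Am : Matrix (Fin N) (Fin N) ℂ)

/-- `Φ(α, β, l) = 𝒜₊ Φ⁺(α, β, l) + 𝒜₋ Φ⁻(α, β, l)`. -/
def Phi (a b : ℂ) (α β n m : ℤ) (l : ℕ) : Fin N → ℂ :=
  Ap.mulVec (fun s => phi p q c a b α β n m l 1 (s : ℕ)) +
    Am.mulVec (fun s => phi p q c a b α β n m l (-1) (s : ℕ))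

/-- The Casoratian `|Φ(α, β, 0), Φ(α, β, 1), …, Φ(α, β, N - 1)|`. -/
def casoratian (a b : ℂ) (α β n m : ℤ) : ℂ :=
  Matrix.det (Matrix.of fun i l : Fin N => Phi p q c Ap Am a b α β n m (l : ℕ) i)

/-- `f = |Φ(0, 0, 0), …, Φ(0, 0, N - 1)|`. Since `α = β = 0`, it does not depend on the
parameters `a` and `b`, which are set to `1` here. -/
def fCas (n m : ℤ) : ℂ :=
  casoratian p q c Ap Am 1 1 0 0 n m

/-- `θ = -((ab)^N |Φ(-1, -1, ·)| - |Φ(0, 0, ·)|) / (a + b)`, for `a + b ≠ 0`. -/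
def thetaCas (a b : ℂ) (n m : ℤ) : ℂ :=
  -(1 / (a + b)) *
    ((a * b) ^ N * casoratian p q c Ap Am a b (-1) (-1) n m - fCas p q c Ap Am n m)

/-- `S(a, b) = θ / f`, where the value at `b = -a` (a removable singularity) is the limit. -/
def SNQC (a b : ℂ) (n m : ℤ) : ℂ :=
  open Classical in
  if a + b = 0 then
    limUnder (𝓝[≠] b) (fun b' => thetaCas p q c Ap Am a b' n m / fCas p q c Ap Am n m)
  else
    thetaCas p q c Ap Am a b n m / fCas p q c Ap Am n m

end Casoratian

/-- `ξ = 2a (p n / (a² - p²) + q m / (a² - q²))`. -/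
def xi (p q a : ℂ) (n m : ℤ) : ℂ :=
  2 * a * (p / (a ^ 2 - p ^ 2) * n + q / (a ^ 2 - q ^ 2) * m)

/-- `ρ(a) = ((p + a)/(p - a))^n ((q + a)/(q - a))^m`. -/
def rho (p q a : ℂ) (n m : ℤ) : ℂ :=
  ((p + a) / (p - a)) ^ n * ((q + a) / (q - a)) ^ m

section Solutions

variable {N : ℕ} (p q c : ℂ) (Ap Am : Matrix (Fin N) (Fin N) ℂ) (a : ℂ)

/-- `U(a, -a) = -(1/(2a)) ∂_ε S(a, 2aε - a)` at `ε = 0`. -/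
def UUleft (n m : ℤ) : ℂ :=
  -(1 / (2 * a)) * deriv (fun ε : ℂ => SNQC p q c Ap Am a (2 * a * ε - a) n m) 0

/-- `U(-a, a) = (1/(2a)) ∂_ε S(-a, a - 2aε)` at `ε = 0`. -/
def UUright (n m : ℤ) : ℂ :=
  1 / (2 * a) * deriv (fun ε : ℂ => SNQC p q c Ap Am (-a) (a - 2 * a * ε) n m) 0

/-- The Q2 solution formula with constants `A`, `D`, `ξ₀`. -/
def uQ2 (A D ξ₀ : ℂ) (n m : ℤ) : ℂ :=
  1 / 4 * ((xi p q a n m + ξ₀) ^ 2 + 1)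
    + a * (xi p q a n m + ξ₀) * SNQC p q c Ap Am (-a) a n m
    + a ^ 2 * (UUleft p q c Ap Am a n m + UUright p q c Ap Am a n m)
    + A * D
    + 1 / 2 * A * rho p q a n m * (1 - 2 * a * SNQC p q c Ap Am a a n m)
    + 1 / 2 * D * rho p q (-a) n m * (1 + 2 * a * SNQC p q c Ap Am (-a) (-a) n m)

/-- The Q1 solution formula with constants `A`, `B`, `D`, `ξ₀`. -/
def uQ1 (A B D ξ₀ : ℂ) (n m : ℤ) : ℂ :=
  A * rho p q a n m * (1 - 2 * a * SNQC p q c Ap Am a a n m)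
    + B * (xi p q a n m + ξ₀ + 2 * a * SNQC p q c Ap Am (-a) a n m)
    + D * rho p q (-a) n m * (1 + 2 * a * SNQC p q c Ap Am (-a) (-a) n m)

end Solutions

/-- The lattice equation `Q1_δ` on the elementary quadrilateral with lower left corner `(n, m)`. -/
def Q1At (p q a δ : ℂ) (u : ℤ → ℤ → ℂ) (n m : ℤ) : Prop :=
  (q ^ 2 - a ^ 2) * (u n m - u n (m + 1)) * (u (n + 1) m - u (n + 1) (m + 1))
    - (p ^ 2 - a ^ 2) * (u n m - u (n + 1) m) * (u n (m + 1) - u (n + 1) (m + 1))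
    = δ ^ 2 * a ^ 4 * (p ^ 2 - q ^ 2) / ((p ^ 2 - a ^ 2) * (q ^ 2 - a ^ 2))

end RationalABS

end

/-! Only even derivatives at `k = 0` enter, so the two signs give the same `φ_s` and `Φ = (𝒜₊ + 𝒜₋)
Φ⁺`. Every Casoratian is therefore `det (𝒜₊ + 𝒜₋)` times F(h) = `evenDet N h`, with h the Taylor
series of the plane wave, and the constant cancels in `S`. The steps `n + 1` and `m + 1` multiply h
by p + X and q + X. Since F ignores even factors 1 - r X² (row operations), the numerator in `S(a,
b)` becomes F(h (1 - X/a)(1 - X/b)).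

F satisfies the Hirota–Miwa relation (`evenDet_hirota`), a Plücker relation for bordered
determinants. Specialising its parameters to p and ±a, and once differentiating in a parameter,
gives all that is needed about the shifts: `evenDet_wronskian`, `evenDet_diagonal`,
`evenDetDeriv_shift`.

Attach to each lattice point the vector with entries F(h (1 + X/a))/F(h) and F(h (1 - X/a))/F(h). By
`uSeries_sub_shift` the difference of `u` along an edge is a bilinear form in the two end vectors,
and by `evenDet_wronskian` these vectors have a constant weighted Wronskian 2a. `Q1` is then an
algebraic identity (`quad_identity`), in which the constraint on `A, B, D` fixes the discriminant of
the form.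

For the degeneration, the poles in `ε` cancel identically by that same constraint, and what remains
is affine in `ε`. -/

namespace RationalABS

/-! ### Determinant identities -/

open Polynomial in
/-- The determinant of linear functionals evaluated at monic polynomials of degrees `0, 1, …` does
not depend on the polynomials. -/
theorem det_functional_monic {M : ℕ} (R : Fin M → (ℂ[X] →ₗ[ℂ] ℂ)) (P : Fin M → ℂ[X])
    (hdeg : ∀ i, (P i).natDegree = i) (hmon : ∀ i, (P i).Monic) :
    (Matrix.of fun i j => R i (P j)).det =
      (Matrix.of fun i j : Fin M => R i (X ^ (j : ℕ))).det := by
  have h : (Matrix.of fun i j => R i (P j)) =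
      (Matrix.of fun i j : Fin M => R i (X ^ (j : ℕ))) *
        (Matrix.of fun i j : Fin M => (P j).coeff i) := by
    ext i j
    rw [Matrix.mul_apply]
    simp only [Matrix.of_apply]
    conv_lhs => rw [(P j).as_sum_range' M (by rw [hdeg]; exact j.2)]
    rw [map_sum, ← Fin.sum_univ_eq_sum_range (fun r => R i (monomial r ((P j).coeff r)))]
    refine Finset.sum_congr rfl fun r _ => ?_
    rw [← C_mul_X_pow_eq_monomial, ← smul_eq_C_mul, map_smul, smul_eq_mul, mul_comm]
  rw [h, Matrix.det_mul, Matrix.det_matrixOfPolynomials P hdeg hmon, mul_one]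

/-- The three-term Plücker relation for determinants sharing all rows but two. -/
theorem det_plucker {N : ℕ} (L : Fin N → Fin (N + 2) → ℂ) (u v w t : Fin (N + 2) → ℂ) :
    (Matrix.of (Fin.cons u (Fin.cons v L) : Fin (N + 2) → Fin (N + 2) → ℂ)).det *
        (Matrix.of (Fin.cons w (Fin.cons t L) : Fin (N + 2) → Fin (N + 2) → ℂ)).det =
      (Matrix.of (Fin.cons w (Fin.cons v L) : Fin (N + 2) → Fin (N + 2) → ℂ)).det *
        (Matrix.of (Fin.cons u (Fin.cons t L) : Fin (N + 2) → Fin (N + 2) → ℂ)).det +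
      (Matrix.of (Fin.cons u (Fin.cons w L) : Fin (N + 2) → Fin (N + 2) → ℂ)).det *
        (Matrix.of (Fin.cons v (Fin.cons t L) : Fin (N + 2) → Fin (N + 2) → ℂ)).det := by
  set A : Matrix (Fin (N + 2)) (Fin (N + 2)) ℂ := Matrix.of (Fin.cons u (Fin.cons v L)) with hA
  set T : Matrix (Fin (N + 2)) (Fin (N + 2)) ℂ := Matrix.of (Fin.cons 0 (Fin.cons t L)) with hT
  let ℓ : (Fin (N + 2) → ℂ) →ₗ[ℂ] ℂ := LinearMap.proj 0 ∘ₗ T.transpose.cramer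
  have hℓ : ∀ y, ℓ y =
      (Matrix.of (Fin.cons y (Fin.cons t L) : Fin (N + 2) → Fin (N + 2) → ℂ)).det := by
    intro y
    have : T.updateRow 0 y = Matrix.of (Fin.cons y (Fin.cons t L)) := by
      ext i j
      refine Fin.cases ?_ (fun i => ?_) i <;> simp [hT, Matrix.updateRow_apply]
    rw [← this, ← Matrix.cramer_transpose_apply]
    rfl
  have hℓL : ∀ s, ℓ (L s) = 0 := by
    intro s
    rw [hℓ]
    refine Matrix.det_zero_of_row_eq (i := 0) (j := s.succ.succ) (Fin.succ_ne_zero _).symm ?_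
    ext j
    simp
  -- Cramer's rule expands det(A) w in the rows of `A`. Applying `ℓ` kills the rows from `L`, and
  -- the rows `u`, `v` give the two terms.
  have hc := Matrix.mulVec_cramer A.transpose w
  have hc' : A.det • w = ∑ i, (A.updateRow i w).det • A i := by
    rw [← A.det_transpose, ← hc]
    ext j
    simp [Matrix.mulVec, dotProduct, Matrix.cramer_transpose_apply, mul_comm]
  have h0 : A.updateRow 0 w = Matrix.of (Fin.cons w (Fin.cons v L)) := by
    ext i j
    refine Fin.cases ?_ (fun i => ?_) i <;> simp [hA, Matrix.updateRow_apply]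
  have h1 : A.updateRow 1 w = Matrix.of (Fin.cons u (Fin.cons w L)) := by
    ext i j
    refine Fin.cases ?_ (fun i => Fin.cases ?_ (fun i => ?_) i) i
    · simp [hA, Matrix.updateRow_apply]
    · simp [hA, Matrix.updateRow_apply]
    · have : i.succ.succ ≠ 1 := by
        intro h
        have := congrArg Fin.val h
        simp at this
      simp [hA, Matrix.updateRow_apply, this]
  have := congrArg ℓ hc'
  rw [map_smul, map_sum, Fin.sum_univ_succ, Fin.sum_univ_succ, Finset.sum_eq_zero, add_zero] at this
  · simp only [map_smul, smul_eq_mul, Fin.succ_zero_eq_one, h0, h1] at this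
    have hA0 : A 0 = u := rfl
    have hA1 : A 1 = v := rfl
    rw [hA0, hA1, hℓ, hℓ, hℓ] at this
    exact this
  · intro i _
    have : A i.succ.succ = L i := rfl
    rw [map_smul, this, hℓL, smul_zero]

/-! ### Determinants of even coefficients -/

open PowerSeries

/-- The determinant of the coefficients of `h, X h, …, X ^ (N - 1) h` in even degrees. -/
noncomputable def evenDet (N : ℕ) (h : ℂ⟦X⟧) : ℂ :=
  (Matrix.of fun s l : Fin N => coeff (2 * (s : ℕ)) (h * X ^ (l : ℕ))).det

/-- The functional `P ↦ [X ^ (2 s)] (h P)`. -/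
noncomputable def evenFunctional (h : ℂ⟦X⟧) (s : ℕ) : Polynomial ℂ →ₗ[ℂ] ℂ :=
  (coeff (R := ℂ) (2 * s)) ∘ₗ LinearMap.mulLeft ℂ h ∘ₗ
    (Polynomial.coeToPowerSeries.algHom (R := ℂ) ℂ).toLinearMap

theorem evenFunctional_apply (h : ℂ⟦X⟧) (s : ℕ) (P : Polynomial ℂ) :
    evenFunctional h s P = coeff (2 * s) (h * (P : ℂ⟦X⟧)) := by
  simp [evenFunctional, Polynomial.coeToPowerSeries.algHom_apply]

theorem evenDet_eq_functional (N : ℕ) (h : ℂ⟦X⟧) (g : Polynomial ℂ) :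
    (Matrix.of fun s l : Fin N =>
      evenFunctional h s (g * Polynomial.X ^ (l : ℕ))).det = evenDet N (h * g) := by
  simp only [evenFunctional_apply, evenDet, Polynomial.coe_mul, Polynomial.coe_pow,
    Polynomial.coe_X, mul_assoc]

theorem evenDet_monic (N : ℕ) (h : ℂ⟦X⟧) (c : ℂ) :
    (Matrix.of fun s l : Fin N => coeff (2 * (s : ℕ)) (h * (C c + X) ^ (l : ℕ))).det =
      evenDet N h := by
  have := det_functional_monic (fun s : Fin N => evenFunctional h s)
    (fun l => (Polynomial.X + Polynomial.C c) ^ (l : ℕ)) (fun i => by simp)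
    (fun i => (Polynomial.monic_X_add_C c).pow _)
  simp only [evenFunctional_apply, Polynomial.coe_pow, Polynomial.coe_add, Polynomial.coe_X,
    Polynomial.coe_C] at this
  rw [add_comm (C c), this, evenDet]

theorem evenDet_C_mul (N : ℕ) (h : ℂ⟦X⟧) (r : ℂ) : evenDet N (C r * h) = r ^ N * evenDet N h := by
  have : (Matrix.of fun s l : Fin N => coeff (2 * (s : ℕ)) (C r * h * X ^ (l : ℕ))) =
      r • (Matrix.of fun s l : Fin N => coeff (2 * (s : ℕ)) (h * X ^ (l : ℕ))) := by
    ext s l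
    simp [mul_assoc]
  rw [evenDet, this, Matrix.det_smul, Fintype.card_fin, evenDet]

/-- Multiplication by X² moves row s - 1 to row s, so the factor subtracts `r` times the preceding
row from each row; row 0 is unchanged. -/
theorem evenDet_mul_even (N : ℕ) (h : ℂ⟦X⟧) (r : ℂ) :
    evenDet N (h * (1 - C r * X ^ 2)) = evenDet N h := by
  let B : Matrix (Fin N) (Fin N) ℂ := Matrix.of fun i j =>
    if j = i then 1 else if (j : ℕ) + 1 = i then -r else 0
  have hB : B.det = 1 := by
    rw [Matrix.det_of_isLowerTriangular]
    · simp [B]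
    · intro i j hij
      have hij : i < j := by simpa using hij
      have h1 : j ≠ i := hij.ne'
      have h2 : (j : ℕ) + 1 ≠ i := by have := Fin.lt_def.mp hij; omega
      simp [B, h1, h2]
  have : (Matrix.of fun s l : Fin N =>
      coeff (2 * (s : ℕ)) (h * (1 - C r * X ^ 2) * X ^ (l : ℕ))) =
      B * (Matrix.of fun s l : Fin N => coeff (2 * (s : ℕ)) (h * X ^ (l : ℕ))) := by
    ext s l
    rw [Matrix.mul_apply]
    have e : h * (1 - C r * X ^ 2) * X ^ (l : ℕ) =
      h * X ^ (l : ℕ) - C r * ((h * X ^ (l : ℕ)) * X ^ 2) := by ring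
    simp only [Matrix.of_apply, B, e]
    rcases s with ⟨s, hs⟩
    cases s with
    | zero =>
      rw [Finset.sum_eq_single (⟨0, hs⟩ : Fin N)]
      · simp
      · intro b _ hb
        simp [hb]
      · simp
    | succ s =>
      rw [Fintype.sum_eq_add (⟨s + 1, hs⟩ : Fin N) (⟨s, by omega⟩ : Fin N)]
      · have h3 : 2 * (s + 1) = 2 * s + 2 := by ring
        simp only [h3, map_sub, coeff_C_mul, coeff_mul_X_pow, if_true, Fin.mk.injEq,
          Nat.left_eq_add, Nat.succ_ne_self, if_false]
        simp
        ring
      · simp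
      · rintro b ⟨hb1, hb2⟩
        have : ¬ ((b : ℕ) + 1 = s + 1) := fun hh => hb2 (Fin.ext (by simpa using hh))
        simp only [hb1, if_false, this, zero_mul]
  rw [evenDet, this, Matrix.det_mul, hB, one_mul, evenDet]

/-! ### Bordered determinants and the Hirota–Miwa relation -/

/-- The determinant bordered by two functionals `u` and `v`. -/
noncomputable def borderDet (N : ℕ) (h : ℂ⟦X⟧) (u v : Polynomial ℂ →ₗ[ℂ] ℂ) : ℂ :=
  (Matrix.of fun i j : Fin (N + 2) =>
    (Fin.cons u (Fin.cons v fun s : Fin N => evenFunctional h s) :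
      Fin (N + 2) → (Polynomial ℂ →ₗ[ℂ] ℂ)) i (Polynomial.X ^ (j : ℕ))).det

theorem borderDet_plucker (N : ℕ) (h : ℂ⟦X⟧) (u v w t : Polynomial ℂ →ₗ[ℂ] ℂ) :
    borderDet N h u v * borderDet N h w t =
      borderDet N h w v * borderDet N h u t + borderDet N h u w * borderDet N h v t := by
  have key : ∀ u v : Polynomial ℂ →ₗ[ℂ] ℂ, borderDet N h u v =
      (Matrix.of (Fin.cons (fun j : Fin (N + 2) => u (Polynomial.X ^ (j : ℕ)))
        (Fin.cons (fun j : Fin (N + 2) => v (Polynomial.X ^ (j : ℕ)))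
          fun (s : Fin N) (j : Fin (N + 2)) => evenFunctional h s (Polynomial.X ^ (j : ℕ))) :
          Fin (N + 2) → Fin (N + 2) → ℂ)).det := by
    intro u v
    rw [borderDet]
    congr 1
    ext i j
    refine Fin.cases ?_ (fun i => Fin.cases ?_ (fun i => ?_) i) i <;> simp
  simp only [key]
  exact det_plucker _ _ _ _ _

/-- In the monic basis 1, X + x, (X + x)(X + y) X^l, evaluation at -x kills all but the first
element, and evaluation at -y kills everything from the third on and takes the second to x - y. -/
theorem borderDet_leval (N : ℕ) (h : ℂ⟦X⟧) (x y : ℂ) :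
    borderDet N h (Polynomial.leval (-x)) (Polynomial.leval (-y)) =
      (x - y) * evenDet N (h * (C x + X) * (C y + X)) := by
  let P : Fin (N + 2) → Polynomial ℂ := Fin.cons 1 (Fin.cons (Polynomial.X + Polynomial.C x)
    fun l : Fin N => ((Polynomial.X + Polynomial.C x) * (Polynomial.X + Polynomial.C y)) *
      Polynomial.X ^ (l : ℕ))
  have hm : ((Polynomial.X + Polynomial.C x) * (Polynomial.X + Polynomial.C y)).Monic :=
    (Polynomial.monic_X_add_C x).mul (Polynomial.monic_X_add_C y)
  have hP0 : P 0 = 1 := rfl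
  have hP1 : P 1 = Polynomial.X + Polynomial.C x := rfl
  have hP2 : ∀ l : Fin N, P l.succ.succ = ((Polynomial.X + Polynomial.C x) *
    (Polynomial.X + Polynomial.C y)) * Polynomial.X ^ (l : ℕ) := fun _ => rfl
  rw [borderDet, ← det_functional_monic _ P]
  · rw [Matrix.det_succ_row_zero, Fin.sum_univ_succ, Finset.sum_eq_zero]
    · rw [Matrix.det_succ_row_zero, Fin.sum_univ_succ, Finset.sum_eq_zero]
      · have e : evenDet N (h * (C x + X) * (C y + X)) = evenDet N (h *
            (((Polynomial.X + Polynomial.C x) * (Polynomial.X + Polynomial.C y) :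
              Polynomial ℂ) : ℂ⟦X⟧)) := by
          congr 1
          simp only [Polynomial.coe_mul, Polynomial.coe_add, Polynomial.coe_X, Polynomial.coe_C]
          ring
        rw [e, ← evenDet_eq_functional]
        simp [hP0, hP1, hP2, Matrix.submatrix, neg_add_eq_sub]
      · intro i _
        simp [Matrix.submatrix, hP2]
    · intro i _
      refine Fin.cases ?_ (fun i => ?_) i
      · simp [hP1]
      · simp [hP2]
  · intro i
    refine Fin.cases ?_ (fun i => Fin.cases ?_ (fun i => ?_) i) i
    · simp [hP0]
    · simp [hP1]
    · rw [hP2, hm.natDegree_mul (Polynomial.monic_X_pow _),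
        (Polynomial.monic_X_add_C x).natDegree_mul (Polynomial.monic_X_add_C y)]
      simp
      omega
  · intro i
    refine Fin.cases ?_ (fun i => Fin.cases ?_ (fun i => ?_) i) i
    · simp [hP0]
    · simpa [hP1] using Polynomial.monic_X_add_C x
    · rw [hP2]
      exact hm.mul (Polynomial.monic_X_pow _)

/-- In the basis 1, (X + x) X^l, evaluation at -x sees only the first element and the top
coefficient only the last; expanding along that last column gives the sign. -/
theorem borderDet_lcoeff (N : ℕ) (h : ℂ⟦X⟧) (x : ℂ) :
    borderDet N h (Polynomial.leval (-x)) (Polynomial.lcoeff ℂ (N + 1)) =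
      (-1) ^ N * evenDet N (h * (C x + X)) := by
  let P : Fin (N + 2) → Polynomial ℂ := Fin.cons 1
    fun l : Fin (N + 1) => (Polynomial.X + Polynomial.C x) * Polynomial.X ^ (l : ℕ)
  have hm := Polynomial.monic_X_add_C x
  have hP0 : P 0 = 1 := rfl
  have hP2 : ∀ l : Fin (N + 1), P l.succ = (Polynomial.X + Polynomial.C x) *
    Polynomial.X ^ (l : ℕ) := fun _ => rfl
  have hdeg : ∀ i, (P i).natDegree = i := by
    intro i
    refine Fin.cases ?_ (fun i => ?_) i
    · simp [hP0]
    · rw [hP2, hm.natDegree_mul (Polynomial.monic_X_pow _)]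
      simp
      omega
  have hmon : ∀ i, (P i).Monic := by
    intro i
    refine Fin.cases ?_ (fun i => ?_) i
    · simp [hP0]
    · rw [hP2]
      exact hm.mul (Polynomial.monic_X_pow _)
  rw [borderDet, ← det_functional_monic _ P hdeg hmon]
  rw [Matrix.det_succ_row_zero, Fin.sum_univ_succ, Finset.sum_eq_zero]
  · rw [Matrix.det_succ_row_zero, Fin.sum_univ_castSucc, Finset.sum_eq_zero]
    · have e : evenDet N (h * (C x + X)) = evenDet N (h *
          ((Polynomial.X + Polynomial.C x : Polynomial ℂ) : ℂ⟦X⟧)) := by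
        congr 1
        simp only [Polynomial.coe_add, Polynomial.coe_X, Polynomial.coe_C]
        ring
      have e2 : (P (Fin.last (N + 1))).coeff (N + 1) = 1 := by
        have := (hmon (Fin.last (N + 1))).coeff_natDegree
        rwa [hdeg] at this
      rw [e, ← evenDet_eq_functional]
      simp [hP0, e2, Matrix.submatrix]
      congr 1
    · intro i _
      have : (P i.castSucc.succ).coeff (N + 1) = 0 := by
        refine Polynomial.coeff_eq_zero_of_natDegree_lt ?_
        rw [hdeg]
        simp
      simp [Matrix.submatrix, this]
  · intro i _
    simp [hP2]

/-- The three-term bilinear (Hirota–Miwa) relation. -/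
theorem evenDet_hirota (N : ℕ) (h : ℂ⟦X⟧) (x y z : ℂ) :
    (x - y) * evenDet N (h * (C x + X) * (C y + X)) * evenDet N (h * (C z + X)) +
      (y - z) * evenDet N (h * (C y + X) * (C z + X)) * evenDet N (h * (C x + X)) +
      (z - x) * evenDet N (h * (C z + X) * (C x + X)) * evenDet N (h * (C y + X)) = 0 := by
  -- The top coefficient on degree at most N + 1 plays the role of evaluation at infinity.
  have := borderDet_plucker N h (Polynomial.leval (-x)) (Polynomial.leval (-y))
    (Polynomial.leval (-z)) (Polynomial.lcoeff ℂ (N + 1))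
  simp only [borderDet_leval, borderDet_lcoeff] at this
  have hN : ((-1 : ℂ) ^ N) * (-1) ^ N = 1 := by rw [← mul_pow]; simp
  have e1 : h * (C z + X) * (C y + X) = h * (C y + X) * (C z + X) := by ring
  have e2 : h * (C x + X) * (C z + X) = h * (C z + X) * (C x + X) := by ring
  rw [e1, e2] at this
  linear_combination ((-1) ^ N : ℂ) * this - ((x - y) * evenDet N (h * (C x + X) * (C y + X)) *
    evenDet N (h * (C z + X)) +
      (y - z) * evenDet N (h * (C y + X) * (C z + X)) * evenDet N (h * (C x + X)) +
      (z - x) * evenDet N (h * (C z + X) * (C x + X)) * evenDet N (h * (C y + X))) * hN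

/-! ### Normalised factors and the shift relations -/

/-- The factor `1 + X / x`. -/
noncomputable def normFactor (x : ℂ) : ℂ⟦X⟧ := 1 + C x⁻¹ * X

theorem C_mul_normFactor {x : ℂ} (hx : x ≠ 0) : C x * normFactor x = C x + X := by
  rw [normFactor, mul_add, mul_one, ← mul_assoc, ← map_mul, mul_inv_cancel₀ hx, map_one, one_mul]

theorem normFactor_mul_neg (x : ℂ) :
    normFactor x * normFactor (-x) = 1 - C (x⁻¹ ^ 2) * X ^ 2 := by
  simp only [normFactor, inv_neg, map_neg, map_pow]
  ring

theorem evenDet_normFactor_neg (N : ℕ) (h : ℂ⟦X⟧) (x : ℂ) :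
    evenDet N (h * normFactor x * normFactor (-x)) = evenDet N h := by
  rw [mul_assoc, normFactor_mul_neg, evenDet_mul_even]

theorem evenDet_add_X_mul_normFactor (N : ℕ) (h : ℂ⟦X⟧) (p : ℂ) {y z : ℂ} (hy : y ≠ 0)
    (hz : z ≠ 0) :
    (p - y) * evenDet N (h * (C p + X) * normFactor y) * evenDet N (h * normFactor z) +
      (y - z) * evenDet N (h * normFactor y * normFactor z) * evenDet N (h * (C p + X)) +
      (z - p) * evenDet N (h * (C p + X) * normFactor z) * evenDet N (h * normFactor y) = 0 := by
  have H := evenDet_hirota N h p y z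
  rw [← C_mul_normFactor hy, ← C_mul_normFactor hz] at H
  have e1 : h * (C p + X) * (C y * normFactor y) = C y * (h * (C p + X) * normFactor y) := by ring
  have e2 : h * (C z * normFactor z) = C z * (h * normFactor z) := by ring
  have e3 : h * (C y * normFactor y) * (C z * normFactor z) =
    C y * (C z * (h * normFactor y * normFactor z)) := by ring
  have e4 : h * (C z * normFactor z) * (C p + X) = C z * (h * (C p + X) * normFactor z) := by ring
  have e5 : h * (C y * normFactor y) = C y * (h * normFactor y) := by ring
  rw [e4, e1, e3, e2, e5] at H
  simp only [evenDet_C_mul] at H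
  have : y ^ N * z ^ N ≠ 0 := mul_ne_zero (pow_ne_zero _ hy) (pow_ne_zero _ hz)
  refine (mul_eq_zero.mp ?_).resolve_left this
  linear_combination H

/-- Parameters p, a, -a in the Hirota–Miwa relation: the pair a, -a forms an even factor and
disappears. -/
theorem evenDet_wronskian (N : ℕ) (h : ℂ⟦X⟧) (p : ℂ) {a : ℂ} (ha : a ≠ 0) :
    (p + a) * evenDet N (h * (C p + X) * normFactor (-a)) * evenDet N (h * normFactor a) -
      (p - a) * evenDet N (h * (C p + X) * normFactor a) * evenDet N (h * normFactor (-a)) =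
      2 * a * evenDet N h * evenDet N (h * (C p + X)) := by
  have H := evenDet_add_X_mul_normFactor N h p ha (neg_ne_zero.mpr ha)
  rw [evenDet_normFactor_neg] at H
  linear_combination -H

theorem evenDet_diagonal (N : ℕ) (h : ℂ⟦X⟧) (p : ℂ) {a : ℂ} (ha : a ≠ 0) :
    (p - a) * evenDet N (h * normFactor (-a) * normFactor (-a)) * evenDet N (h * (C p + X)) -
      (p + a) * evenDet N (h * (C p + X) * normFactor (-a) * normFactor (-a)) * evenDet N h =
      -2 * a * evenDet N (h * normFactor (-a)) * evenDet N (h * (C p + X) * normFactor (-a)) := by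
  have H := evenDet_add_X_mul_normFactor N (h * normFactor (-a)) p ha (neg_ne_zero.mpr ha)
  have e1 : h * normFactor (-a) * (C p + X) * normFactor a =
    h * (C p + X) * normFactor a * normFactor (-a) := by ring
  have e3 : h * normFactor (-a) * (C p + X) * normFactor (-a) =
    h * (C p + X) * normFactor (-a) * normFactor (-a) := by ring
  have e4 : h * normFactor (-a) * normFactor a = h * normFactor a * normFactor (-a) := by ring
  have e5 : h * normFactor (-a) * (C p + X) = h * (C p + X) * normFactor (-a) := by ring
  have e6 : h * normFactor a * normFactor (-a) * normFactor (-a) =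
    h * normFactor (-a) * normFactor a * normFactor (-a) := by ring
  rw [e1, e3, e4, e5, e6, evenDet_normFactor_neg, evenDet_normFactor_neg,
    evenDet_normFactor_neg] at H
  linear_combination H

/-- The matrix entries are affine in b⁻¹. -/
theorem differentiableAt_evenDet_normFactor (N : ℕ) (h : ℂ⟦X⟧) {b : ℂ} (hb : b ≠ 0) :
    DifferentiableAt ℂ (fun b => evenDet N (h * normFactor (-b))) b := by
  have e : ∀ (b : ℂ) (s l : Fin N),
      coeff (2 * (s : ℕ)) (h * normFactor (-b) * X ^ (l : ℕ)) =
        coeff (2 * (s : ℕ)) (h * X ^ (l : ℕ)) - b⁻¹ * coeff (2 * (s : ℕ)) (h * X * X ^ (l : ℕ)) := by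
    intro b s l
    rw [← coeff_C_mul, ← map_sub]
    congr 1
    simp only [normFactor, inv_neg, map_neg]
    ring
  simp only [evenDet, Matrix.det_apply, Matrix.of_apply, e]
  have hinv : DifferentiableAt ℂ (fun b : ℂ => b⁻¹) b := differentiableAt_inv hb
  refine DifferentiableAt.fun_sum fun σ _ => DifferentiableAt.const_smul ?_ _
  refine DifferentiableAt.fun_finsetProd fun i _ => ?_
  exact (differentiableAt_const _).sub (hinv.mul (differentiableAt_const _))

/-- The derivative of `b ↦ F(h (1 + X / a) (1 - X / b))` at `b = a`. -/
noncomputable def evenDetDeriv (N : ℕ) (h : ℂ⟦X⟧) (a : ℂ) : ℂ :=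
  deriv (fun b => evenDet N (h * normFactor a * normFactor (-b))) a

theorem hasDerivAt_evenDet (N : ℕ) (h : ℂ⟦X⟧) {a : ℂ} (ha : a ≠ 0) :
    HasDerivAt (fun b => evenDet N (h * normFactor a * normFactor (-b))) (evenDetDeriv N h a) a :=
  (differentiableAt_evenDet_normFactor N (h * normFactor a) ha).hasDerivAt

/-- At b = a the relation with parameters p, -a, -b, taken for the series h (1 + X/a), is trivial;
its derivative in b there is the claim. -/
theorem evenDetDeriv_shift (N : ℕ) (h : ℂ⟦X⟧) (p : ℂ) {a : ℂ} (ha : a ≠ 0) :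
    (p + a) * (evenDet N (h * (C p + X)) * evenDetDeriv N h a -
      evenDetDeriv N (h * (C p + X)) a * evenDet N h) =
      evenDet N h * evenDet N (h * (C p + X)) -
        evenDet N (h * normFactor (-a)) * evenDet N (h * (C p + X) * normFactor a) := by
  have H : (fun b => (p + a) * evenDet N (h * (C p + X)) *
      evenDet N (h * normFactor a * normFactor (-b)) +
      (b - a) * evenDet N (h * normFactor (-b)) * evenDet N (h * (C p + X) * normFactor a) -
      (b + p) * evenDet N (h * (C p + X) * normFactor a * normFactor (-b)) * evenDet N h) =ᶠ[𝓝 a]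
      fun _ => 0 := by
    filter_upwards [isOpen_ne.mem_nhds ha] with b hb
    have H := evenDet_add_X_mul_normFactor N (h * normFactor a) p (neg_ne_zero.mpr ha)
      (neg_ne_zero.mpr hb)
    have e1 : h * normFactor a * (C p + X) * normFactor (-a) =
      h * (C p + X) * normFactor a * normFactor (-a) := by ring
    have e2 : h * normFactor a * normFactor (-a) * normFactor (-b) =
      h * normFactor (-b) * normFactor a * normFactor (-a) := by ring
    have e3 : h * normFactor a * (C p + X) * normFactor (-b) =
      h * (C p + X) * normFactor a * normFactor (-b) := by ring
    have e4 : h * normFactor a * (C p + X) = h * (C p + X) * normFactor a := by ring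
    rw [e1, e2, e3, e4, evenDet_normFactor_neg, evenDet_normFactor_neg,
      evenDet_normFactor_neg] at H
    linear_combination H
  have h1 := hasDerivAt_evenDet N h ha
  have h2 := hasDerivAt_evenDet N (h * (C p + X)) ha
  have h3 := (differentiableAt_evenDet_normFactor N h ha).hasDerivAt
  have hd := ((h1.const_mul ((p + a) * evenDet N (h * (C p + X)))).add
    ((((hasDerivAt_id a).sub_const a).mul h3).mul_const
      (evenDet N (h * (C p + X) * normFactor a)))).sub
    ((((hasDerivAt_id a).add_const p).mul h2).mul_const (evenDet N h))
  have := hd.unique ((hasDerivAt_const a (0 : ℂ)).congr_of_eventuallyEq H)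
  simp only [id, evenDet_normFactor_neg] at this
  linear_combination this

/-! ### The quadrilateral identity and `Q1` for power series -/

/-- If all differences around a quadrilateral are values of one symmetric bilinear form at vectors
with prescribed Wronskians, then the quadrilateral satisfies `Q1`. -/
theorem quad_identity {a P₁ P₂ Q₁ Q₂ A B D δ r X0 X1 X2 X3 Y0 Y1 Y2 Y3 : ℂ}
    (hP₁ : P₁ ≠ 0) (hP₂ : P₂ ≠ 0) (hQ₁ : Q₁ ≠ 0) (hQ₂ : Q₂ ≠ 0) (hr : r ≠ 0)
    (hABD : A * D + 1 / 4 * B ^ 2 = δ ^ 2 / 16)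
    (h01 : P₁ * Y1 * X0 - P₂ * X1 * Y0 = 2 * a) (h23 : P₁ * Y3 * X2 - P₂ * X3 * Y2 = 2 * a)
    (h02 : Q₁ * Y2 * X0 - Q₂ * X2 * Y0 = 2 * a) (h13 : Q₁ * Y3 * X1 - Q₂ * X3 * Y1 = 2 * a) :
    Q₁ * Q₂ *
        (-2 * a * A * r / Q₂ * Y0 * Y2 + a * B * (Y2 * X0 / Q₂ + X2 * Y0 / Q₁) +
          2 * a * D * r⁻¹ / Q₁ * X0 * X2) *
        (-2 * a * A * (r * (P₁ / P₂)) / Q₂ * Y1 * Y3 + a * B * (Y3 * X1 / Q₂ + X3 * Y1 / Q₁) +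
          2 * a * D * (r * (P₁ / P₂))⁻¹ / Q₁ * X1 * X3) -
      P₁ * P₂ *
        (-2 * a * A * r / P₂ * Y0 * Y1 + a * B * (Y1 * X0 / P₂ + X1 * Y0 / P₁) +
          2 * a * D * r⁻¹ / P₁ * X0 * X1) *
        (-2 * a * A * (r * (Q₁ / Q₂)) / P₂ * Y2 * Y3 + a * B * (Y3 * X2 / P₂ + X3 * Y2 / P₁) +
          2 * a * D * (r * (Q₁ / Q₂))⁻¹ / P₁ * X2 * X3) =
      δ ^ 2 * a ^ 4 * (P₁ * P₂ - Q₁ * Q₂) / ((P₁ * P₂) * (Q₁ * Q₂)) := by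
  -- This rescaling absorbs the change of `r` between vertices: all four edges then carry one form
  -- with coefficients -2aAr, aB, 2aD/r, up to factors P₁P₂ on edge 13 and Q₁Q₂ on edge 23.
  obtain ⟨x1, rfl⟩ : ∃ x, X1 = P₁ * x := ⟨X1 / P₁, by field_simp⟩
  obtain ⟨x2, rfl⟩ : ∃ x, X2 = Q₁ * x := ⟨X2 / Q₁, by field_simp⟩
  obtain ⟨x3, rfl⟩ : ∃ x, X3 = P₁ * Q₁ * x := ⟨X3 / (P₁ * Q₁), by field_simp⟩
  obtain ⟨y1, rfl⟩ : ∃ x, Y1 = P₂ * x := ⟨Y1 / P₂, by field_simp⟩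
  obtain ⟨y2, rfl⟩ : ∃ x, Y2 = Q₂ * x := ⟨Y2 / Q₂, by field_simp⟩
  obtain ⟨y3, rfl⟩ : ∃ x, Y3 = P₂ * Q₂ * x := ⟨Y3 / (P₂ * Q₂), by field_simp⟩
  have k01 : y1 * X0 - x1 * Y0 = 2 * a / (P₁ * P₂) := by
    field_simp; linear_combination h01
  have k02 : y2 * X0 - x2 * Y0 = 2 * a / (Q₁ * Q₂) := by
    field_simp; linear_combination h02
  have k23 : y3 * x2 - x3 * y2 = 2 * a / (P₁ * P₂ * (Q₁ * Q₂)) := by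
    field_simp; linear_combination h23
  have k13 : y3 * x1 - x3 * y1 = 2 * a / (P₁ * P₂ * (Q₁ * Q₂)) := by
    field_simp; linear_combination h13
  have hδ : δ ^ 2 = 16 * (A * D) + 4 * B ^ 2 := by linear_combination -16 * hABD
  -- The discriminant 4AD + B² = δ²/4 does not involve `r`; the products of Wronskians supply the
  -- rest of the right-hand side.
  have hR : δ ^ 2 * a ^ 4 * (P₁ * P₂ - Q₁ * Q₂) / ((P₁ * P₂) * (Q₁ * Q₂)) =
      (P₁ * P₂ * (Q₁ * Q₂)) * a ^ 2 * (4 * (A * D) + B ^ 2) *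
        ((y2 * X0 - x2 * Y0) * (y3 * x1 - x3 * y1) -
          (y1 * X0 - x1 * Y0) * (y3 * x2 - x3 * y2)) := by
    rw [k01, k02, k23, k13, hδ]
    field_simp
    ring
  rw [hR]
  field_simp
  ring

/-- The solution formula with `S` expressed through determinants of a power series. -/
noncomputable def uSeries (N : ℕ) (a A B D ξ r : ℂ) (h : ℂ⟦X⟧) : ℂ :=
  A * r * (evenDet N (h * normFactor (-a) * normFactor (-a)) / evenDet N h) +
    B * (ξ + 2 * a * (-(evenDetDeriv N h a / evenDet N h))) +
    D * r⁻¹ * (evenDet N (h * normFactor a * normFactor a) / evenDet N h)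

theorem uSeries_sub_shift (N : ℕ) {a p : ℂ} (A B D ξ : ℂ) {r : ℂ} {h h' : ℂ⟦X⟧}
    (hh : h' = h * (C p + X)) (ha : a ≠ 0) (hp₁ : p + a ≠ 0) (hp₂ : p - a ≠ 0) (hr : r ≠ 0)
    (h0 : evenDet N h ≠ 0) (h1 : evenDet N h' ≠ 0) :
    uSeries N a A B D ξ r h -
        uSeries N a A B D (ξ - 2 * a * p / ((p + a) * (p - a))) (r * ((p + a) / (p - a))) h' =
      -2 * a * A * r / (p - a) * (evenDet N (h * normFactor (-a)) / evenDet N h) *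
          (evenDet N (h' * normFactor (-a)) / evenDet N h') +
        a * B * ((evenDet N (h' * normFactor (-a)) / evenDet N h') *
            (evenDet N (h * normFactor a) / evenDet N h) / (p - a) +
          (evenDet N (h' * normFactor a) / evenDet N h') *
            (evenDet N (h * normFactor (-a)) / evenDet N h) / (p + a)) +
        2 * a * D * r⁻¹ / (p + a) * (evenDet N (h * normFactor a) / evenDet N h) *
          (evenDet N (h' * normFactor a) / evenDet N h') := by
  have hw := evenDet_wronskian N h p ha
  have hd := evenDet_diagonal N h p ha
  have hd' := evenDet_diagonal N h p (neg_ne_zero.mpr ha)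
  have hs := evenDetDeriv_shift N h p ha
  rw [neg_neg] at hd'
  rw [← hh] at hw hd hd' hs
  have eA : A * r * (evenDet N (h * normFactor (-a) * normFactor (-a)) / evenDet N h) -
      A * (r * ((p + a) / (p - a))) *
        (evenDet N (h' * normFactor (-a) * normFactor (-a)) / evenDet N h') =
      -2 * a * A * r / (p - a) * (evenDet N (h * normFactor (-a)) / evenDet N h) *
          (evenDet N (h' * normFactor (-a)) / evenDet N h') := by
    field_simp
    linear_combination A * hd
  have eD : D * r⁻¹ * (evenDet N (h * normFactor a * normFactor a) / evenDet N h) -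
      D * (r * ((p + a) / (p - a)))⁻¹ *
        (evenDet N (h' * normFactor a * normFactor a) / evenDet N h') =
      2 * a * D * r⁻¹ / (p + a) * (evenDet N (h * normFactor a) / evenDet N h) *
          (evenDet N (h' * normFactor a) / evenDet N h') := by
    field_simp
    linear_combination D * hd'
  -- The derivative relation alone gives a single product of end values; the Wronskian makes it
  -- symmetric in the two ends.
  have eB : (ξ + 2 * a * (-(evenDetDeriv N h a / evenDet N h))) -
      (ξ - 2 * a * p / ((p + a) * (p - a)) + 2 * a * (-(evenDetDeriv N h' a / evenDet N h'))) =
      a * ((evenDet N (h' * normFactor (-a)) / evenDet N h') *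
            (evenDet N (h * normFactor a) / evenDet N h) / (p - a) +
          (evenDet N (h' * normFactor a) / evenDet N h') *
            (evenDet N (h * normFactor (-a)) / evenDet N h) / (p + a)) := by
    field_simp
    linear_combination a * ((-2 * (p - a)) * hs - hw)
  rw [uSeries, uSeries]
  linear_combination eA + B * eB + eD

theorem uSeries_Q1 (N : ℕ) {a p q : ℂ} {A B D δ : ℂ} (ξ : ℂ) {r : ℂ} {h0 h1 h2 h3 : ℂ⟦X⟧}
    (h01 : h1 = h0 * (C p + X)) (h02 : h2 = h0 * (C q + X)) (h13 : h3 = h1 * (C q + X))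
    (ha : a ≠ 0) (hp₁ : p + a ≠ 0) (hp₂ : p - a ≠ 0) (hq₁ : q + a ≠ 0) (hq₂ : q - a ≠ 0)
    (hr : r ≠ 0) (hABD : A * D + 1 / 4 * B ^ 2 = δ ^ 2 / 16)
    (f0 : evenDet N h0 ≠ 0) (f1 : evenDet N h1 ≠ 0) (f2 : evenDet N h2 ≠ 0)
    (f3 : evenDet N h3 ≠ 0) {u0 u1 u2 u3 : ℂ}
    (e0 : u0 = uSeries N a A B D ξ r h0)
    (e1 : u1 = uSeries N a A B D (ξ - 2 * a * p / ((p + a) * (p - a)))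
      (r * ((p + a) / (p - a))) h1)
    (e2 : u2 = uSeries N a A B D (ξ - 2 * a * q / ((q + a) * (q - a)))
      (r * ((q + a) / (q - a))) h2)
    (e3 : u3 = uSeries N a A B D
      (ξ - 2 * a * p / ((p + a) * (p - a)) - 2 * a * q / ((q + a) * (q - a)))
      (r * ((p + a) / (p - a)) * ((q + a) / (q - a))) h3) :
    (q ^ 2 - a ^ 2) * (u0 - u2) * (u1 - u3) - (p ^ 2 - a ^ 2) * (u0 - u1) * (u2 - u3) =
      δ ^ 2 * a ^ 4 * (p ^ 2 - q ^ 2) / ((p ^ 2 - a ^ 2) * (q ^ 2 - a ^ 2)) := by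
  have h23 : h3 = h2 * (C p + X) := by rw [h13, h01, h02]; ring
  have hr1 : r * ((p + a) / (p - a)) ≠ 0 := mul_ne_zero hr (div_ne_zero hp₁ hp₂)
  have hr2 : r * ((q + a) / (q - a)) ≠ 0 := mul_ne_zero hr (div_ne_zero hq₁ hq₂)
  have d01 := uSeries_sub_shift N A B D ξ h01 ha hp₁ hp₂ hr f0 f1
  have d02 := uSeries_sub_shift N A B D ξ h02 ha hq₁ hq₂ hr f0 f2
  have d13 := uSeries_sub_shift N A B D (ξ - 2 * a * p / ((p + a) * (p - a))) h13 ha hq₁ hq₂ hr1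
    f1 f3
  have d23 := uSeries_sub_shift N A B D (ξ - 2 * a * q / ((q + a) * (q - a))) h23 ha hp₁ hp₂ hr2
    f2 f3
  have e3' : u3 = uSeries N a A B D
      (ξ - 2 * a * q / ((q + a) * (q - a)) - 2 * a * p / ((p + a) * (p - a)))
      (r * ((q + a) / (q - a)) * ((p + a) / (p - a))) h3 := by
    rw [e3]
    congr 1 <;> ring
  rw [← e0, ← e1] at d01
  rw [← e0, ← e2] at d02
  rw [← e1, ← e3] at d13
  rw [← e2, ← e3'] at d23
  have wr : ∀ {p : ℂ} {h h' : ℂ⟦X⟧}, h' = h * (C p + X) → evenDet N h ≠ 0 → evenDet N h' ≠ 0 →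
      (p + a) * (evenDet N (h' * normFactor (-a)) / evenDet N h') *
        (evenDet N (h * normFactor a) / evenDet N h) -
      (p - a) * (evenDet N (h' * normFactor a) / evenDet N h') *
        (evenDet N (h * normFactor (-a)) / evenDet N h) = 2 * a := by
    intro p h h' hh f f'
    have hw := evenDet_wronskian N h p ha
    rw [← hh] at hw
    field_simp
    linear_combination hw
  have := quad_identity hp₁ hp₂ hq₁ hq₂ hr hABD (wr h01 f0 f1) (wr h23 f2 f3) (wr h02 f0 f2)
    (wr h13 f1 f3)
  rw [← d01, ← d02, ← d13, ← d23] at this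
  have ep : p ^ 2 - a ^ 2 = (p + a) * (p - a) := by ring
  have eq : q ^ 2 - a ^ 2 = (q + a) * (q - a) := by ring
  have epq : p ^ 2 - q ^ 2 = (p + a) * (p - a) - (q + a) * (q - a) := by ring
  rw [ep, eq, epq]
  exact this

/-! ### From Casoratians to power series -/

/-- The Taylor series at `0`. -/
noncomputable def taylorSeries (w : ℂ → ℂ) : ℂ⟦X⟧ :=
  mk fun j => iteratedDeriv j w 0 / (j.factorial : ℂ)

theorem taylorSeries_congr {w v : ℂ → ℂ} (h : w =ᶠ[𝓝 0] v) : taylorSeries w = taylorSeries v := by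
  ext j
  simp only [taylorSeries, coeff_mk, h.iteratedDeriv_eq j]

theorem taylorSeries_mul {w v : ℂ → ℂ} (hw : AnalyticAt ℂ w 0) (hv : AnalyticAt ℂ v 0) :
    taylorSeries (fun k => w k * v k) = taylorSeries w * taylorSeries v := by
  ext j
  rw [coeff_mul, Finset.Nat.sum_antidiagonal_eq_sum_range_succ_mk]
  simp only [taylorSeries, coeff_mk]
  rw [iteratedDeriv_fun_mul hw.contDiffAt hv.contDiffAt, Finset.sum_div]
  refine Finset.sum_congr rfl fun i hi => ?_
  have hi : i ≤ j := by simpa [Nat.lt_succ_iff] using hi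
  rw [Nat.cast_choose ℂ hi]
  have h1 := Nat.cast_ne_zero (R := ℂ).mpr j.factorial_ne_zero
  have h2 := Nat.cast_ne_zero (R := ℂ).mpr i.factorial_ne_zero
  have h3 := Nat.cast_ne_zero (R := ℂ).mpr (j - i).factorial_ne_zero
  field_simp

theorem taylorSeries_const_add (x : ℂ) : taylorSeries (fun k => x + k) = C x + X := by
  ext j
  rw [taylorSeries, coeff_mk, map_add, coeff_C, coeff_X]
  match j with
  | 0 => simp
  | 1 => simp
  | j + 2 =>
    have : deriv (fun k : ℂ => x + k) = fun _ => 1 := by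
      ext k
      simp
    rw [iteratedDeriv_succ', this, iteratedDeriv_succ']
    simp

theorem analyticAt_const_add (x : ℂ) : AnalyticAt ℂ (fun k : ℂ => x + k) 0 :=
  analyticAt_const.add analyticAt_id

theorem taylorSeries_mul_const_add_pow {w : ℂ → ℂ} (hw : AnalyticAt ℂ w 0) (x : ℂ) (l : ℕ) :
    taylorSeries (fun k => w k * (x + k) ^ l) = taylorSeries w * (C x + X) ^ l := by
  induction l with
  | zero => simp
  | succ l ih =>
    have : (fun k => w k * (x + k) ^ (l + 1)) = fun k => (w k * (x + k) ^ l) * (x + k) := by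
      ext k
      ring
    rw [this, taylorSeries_mul (hw.fun_mul ((analyticAt_const_add x).fun_pow l)) (analyticAt_const_add x),
      ih, taylorSeries_const_add, pow_succ, mul_assoc]

theorem analyticAt_halfPow {c : ℂ} : AnalyticAt ℂ (halfPow c) 0 := by
  unfold halfPow
  refine analyticAt_const.mul (AnalyticAt.cpow ?_ analyticAt_const ?_)
  · exact analyticAt_const.add (analyticAt_id.div_const)
  · simp

theorem eventually_const_add_ne {x : ℂ} (hx : x ≠ 0) : ∀ᶠ k in 𝓝 (0 : ℂ), x + k ≠ 0 := by
  have : Tendsto (fun k : ℂ => x + k) (𝓝 0) (𝓝 x) := by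
    have h : Continuous fun k : ℂ => x + k := by fun_prop
    simpa using h.tendsto 0
  exact this.eventually_ne hx

theorem analyticAt_planeWave {p q c a b : ℂ} (hp : p ≠ 0) (hq : q ≠ 0) (ha : a ≠ 0)
    (hb : b ≠ 0) (α β n m : ℤ) (l : ℕ) :
    AnalyticAt ℂ (fun k => planeWave p q c a b α β n m l 1 k) 0 := by
  simp only [planeWave, one_mul]
  have h : ∀ {x : ℂ}, x ≠ 0 → ∀ j : ℤ, AnalyticAt ℂ (fun k : ℂ => (x + k) ^ j) 0 :=
    fun hx j => (analyticAt_const_add _).fun_zpow (by simpa using hx)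
  exact ((((h hp n).mul (h hq m)).mul (h ha α)).mul (h hb β)).mul
    (((analyticAt_const_add c).pow l).mul analyticAt_halfPow)

/-- The Taylor series of the plane wave factor with `l = 0`. -/
noncomputable def waveSeries (p q c a b : ℂ) (α β n m : ℤ) : ℂ⟦X⟧ :=
  taylorSeries fun k => planeWave p q c a b α β n m 0 1 k

theorem phi_eq_coeff {p q c a b : ℂ} (hp : p ≠ 0) (hq : q ≠ 0) (ha : a ≠ 0)
    (hb : b ≠ 0) (α β n m : ℤ) (l s : ℕ) :
    phi p q c a b α β n m l 1 s =
      coeff (2 * s) (waveSeries p q c a b α β n m * (C c + X) ^ l) := by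
  rw [waveSeries, ← taylorSeries_mul_const_add_pow (analyticAt_planeWave hp hq ha hb α β n m 0),
    taylorSeries, coeff_mk, phi]
  congr 2
  ext k
  simp only [planeWave]
  ring

/-- The sign change is k ↦ -k, invisible to derivatives of even order at 0. -/
theorem phi_neg_one (p q c a b : ℂ) (α β n m : ℤ) (l s : ℕ) :
    phi p q c a b α β n m l (-1) s = phi p q c a b α β n m l 1 s := by
  have : planeWave p q c a b α β n m l (-1) = fun k => planeWave p q c a b α β n m l 1 (-k) := by
    ext k
    simp [planeWave]
  rw [phi, this, iteratedDeriv_comp_neg, phi]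
  simp

/-- Both matrices act on the same vector, so they add up; the columns (c + X)^l are traded for X^l
by `evenDet_monic`, so `c` survives only in the half-power. -/
theorem casoratian_eq_evenDet {N : ℕ} {p q c a b : ℂ} (Ap Am : Matrix (Fin N) (Fin N) ℂ)
    (hp : p ≠ 0) (hq : q ≠ 0) (ha : a ≠ 0) (hb : b ≠ 0) (α β n m : ℤ) :
    casoratian p q c Ap Am a b α β n m =
      (Ap + Am).det * evenDet N (waveSeries p q c a b α β n m) := by
  rw [← evenDet_monic N _ c, ← Matrix.det_mul, casoratian]
  congr 1
  ext i l
  simp only [Phi, phi_neg_one, ← Matrix.add_mulVec, Matrix.of_apply, Matrix.mul_apply,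
    Matrix.mulVec, dotProduct, phi_eq_coeff hp hq ha hb]

theorem waveSeries_add_one_left {p q c : ℂ} (hp : p ≠ 0) (hq : q ≠ 0) (n m : ℤ) :
    waveSeries p q c 1 1 0 0 (n + 1) m = waveSeries p q c 1 1 0 0 n m * (C p + X) := by
  rw [waveSeries, waveSeries, ← taylorSeries_const_add, ← taylorSeries_mul
    (analyticAt_planeWave hp hq one_ne_zero one_ne_zero 0 0 n m 0) (analyticAt_const_add p)]
  refine taylorSeries_congr ?_
  -- The exponent law needs p + k ≠ 0, which holds only near 0; this suffices for Taylor
  -- coefficients.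
  filter_upwards [eventually_const_add_ne hp] with k hk
  simp only [planeWave, one_mul, zpow_add_one₀ hk]
  ring

theorem waveSeries_add_one_right {p q c : ℂ} (hp : p ≠ 0) (hq : q ≠ 0) (n m : ℤ) :
    waveSeries p q c 1 1 0 0 n (m + 1) = waveSeries p q c 1 1 0 0 n m * (C q + X) := by
  rw [waveSeries, waveSeries, ← taylorSeries_const_add, ← taylorSeries_mul
    (analyticAt_planeWave hp hq one_ne_zero one_ne_zero 0 0 n m 0) (analyticAt_const_add q)]
  refine taylorSeries_congr ?_
  filter_upwards [eventually_const_add_ne hq] with k hk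
  simp only [planeWave, one_mul, zpow_add_one₀ hk]
  ring

theorem waveSeries_neg_one_mul {p q c a b : ℂ} (hp : p ≠ 0) (hq : q ≠ 0) (ha : a ≠ 0)
    (hb : b ≠ 0) (n m : ℤ) :
    waveSeries p q c a b (-1) (-1) n m * (C a + X) * (C b + X) =
      waveSeries p q c 1 1 0 0 n m := by
  have hw := analyticAt_planeWave (c := c) hp hq ha hb (-1) (-1) n m 0
  rw [waveSeries, ← taylorSeries_const_add, ← taylorSeries_const_add,
    ← taylorSeries_mul hw (analyticAt_const_add a),
    ← taylorSeries_mul (hw.fun_mul (analyticAt_const_add a)) (analyticAt_const_add b), waveSeries]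
  refine taylorSeries_congr ?_
  filter_upwards [eventually_const_add_ne ha, eventually_const_add_ne hb] with k hka hkb
  simp only [planeWave, one_mul, zpow_neg_one, zpow_zero]
  field_simp

/-- Dividing by (a + X)(b + X) agrees with multiplying by (1 - X/a)(1 - X/b)/(ab) up to even
factors, which the determinant ignores. -/
theorem evenDet_waveSeries_neg_one {N : ℕ} {p q c a b : ℂ} (hp : p ≠ 0) (hq : q ≠ 0)
    (ha : a ≠ 0) (hb : b ≠ 0) (n m : ℤ) :
    (a * b) ^ N * evenDet N (waveSeries p q c a b (-1) (-1) n m) =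
      evenDet N (waveSeries p q c 1 1 0 0 n m * normFactor (-a) * normFactor (-b)) := by
  rw [← waveSeries_neg_one_mul hp hq ha hb, ← C_mul_normFactor ha, ← C_mul_normFactor hb,
    ← evenDet_C_mul, map_mul]
  set V := waveSeries p q c a b (-1) (-1) n m
  have e : V * (C a * normFactor a) * (C b * normFactor b) * normFactor (-a) * normFactor (-b) =
      C a * C b * V * normFactor a * normFactor (-a) * normFactor b * normFactor (-b) := by ring
  rw [e, evenDet_normFactor_neg, evenDet_normFactor_neg]

/-! ### The function `S` and its removable singularity -/

section

variable {N : ℕ} {p q c : ℂ} {Ap Am : Matrix (Fin N) (Fin N) ℂ}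

theorem fCas_eq_evenDet (hp : p ≠ 0) (hq : q ≠ 0) (n m : ℤ) :
    fCas p q c Ap Am n m = (Ap + Am).det * evenDet N (waveSeries p q c 1 1 0 0 n m) :=
  casoratian_eq_evenDet Ap Am hp hq one_ne_zero one_ne_zero 0 0 n m

theorem thetaCas_div_fCas (hp : p ≠ 0) (hq : q ≠ 0) {n m : ℤ} (hf : fCas p q c Ap Am n m ≠ 0)
    {a b : ℂ} (ha : a ≠ 0) (hb : b ≠ 0) :
    thetaCas p q c Ap Am a b n m / fCas p q c Ap Am n m = -(1 / (a + b)) *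
      (evenDet N (waveSeries p q c 1 1 0 0 n m * normFactor (-a) * normFactor (-b)) /
        evenDet N (waveSeries p q c 1 1 0 0 n m) - 1) := by
  rw [fCas_eq_evenDet hp hq] at hf
  have h1 := left_ne_zero_of_mul hf
  have h2 := right_ne_zero_of_mul hf
  rw [thetaCas, fCas_eq_evenDet hp hq, casoratian_eq_evenDet Ap Am hp hq ha hb,
    ← evenDet_waveSeries_neg_one hp hq ha hb]
  field_simp

theorem SNQC_self (hp : p ≠ 0) (hq : q ≠ 0) {n m : ℤ} (hf : fCas p q c Ap Am n m ≠ 0)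
    {a : ℂ} (ha : a ≠ 0) :
    1 - 2 * a * SNQC p q c Ap Am a a n m =
      evenDet N (waveSeries p q c 1 1 0 0 n m * normFactor (-a) * normFactor (-a)) /
        evenDet N (waveSeries p q c 1 1 0 0 n m) := by
  have h : a + a ≠ 0 := by rw [← two_mul]; exact mul_ne_zero two_ne_zero ha
  rw [SNQC, if_neg h, thetaCas_div_fCas hp hq hf ha ha, ← two_mul]
  field_simp
  ring

/-- The function `b ↦ S(a, b)` near its removable singularity. -/
theorem SNQC_eventuallyEq (hp : p ≠ 0) (hq : q ≠ 0) {n m : ℤ} (hf : fCas p q c Ap Am n m ≠ 0)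
    {a : ℂ} (ha : a ≠ 0) :
    (fun b => SNQC p q c Ap Am a b n m) =ᶠ[𝓝 (-a)]
      dslope (fun b => -(evenDet N (waveSeries p q c 1 1 0 0 n m * normFactor (-a) *
        normFactor (-b)) / evenDet N (waveSeries p q c 1 1 0 0 n m))) (-a) := by
  have hf' := hf
  rw [fCas_eq_evenDet hp hq] at hf'
  have h2 := right_ne_zero_of_mul hf'
  set h := waveSeries p q c 1 1 0 0 n m
  set g : ℂ → ℂ := fun b =>
    -(evenDet N (h * normFactor (-a) * normFactor (-b)) / evenDet N h) with hg
  -- With this value, S(a, b) is the difference quotient of `g` between -a and b, so `dslope` is its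
  -- extension to b = -a.
  have hga : g (-a) = -1 := by
    simp only [hg]
    rw [evenDet_normFactor_neg, div_self h2]
  have hgd : DifferentiableAt ℂ g (-a) :=
    ((differentiableAt_evenDet_normFactor N (h * normFactor (-a))
      (neg_ne_zero.mpr ha)).div_const _).neg
  have key : ∀ b, b ≠ 0 → b ≠ -a →
      thetaCas p q c Ap Am a b n m / fCas p q c Ap Am n m = dslope g (-a) b := by
    intro b hb hba
    have hab : a + b ≠ 0 := fun h => hba (eq_neg_of_add_eq_zero_right h)
    have hba' : b - -a ≠ 0 := sub_ne_zero.mpr hba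
    rw [dslope_of_ne _ hba, slope_def_field, hga, thetaCas_div_fCas hp hq hf ha hb]
    change -(1 / (a + b)) *
      (evenDet N (h * normFactor (-a) * normFactor (-b)) / evenDet N h - 1) = _
    simp only [hg]
    rw [show b - -a = a + b by ring]
    field_simp
    ring
  filter_upwards [isOpen_ne.mem_nhds (neg_ne_zero.mpr ha)] with b hb
  rw [SNQC]
  split_ifs with hab
  · obtain rfl : b = -a := eq_neg_of_add_eq_zero_right hab
    refine Tendsto.limUnder_eq ?_
    have hc : ContinuousAt (dslope g (-a)) (-a) := continuousAt_dslope_same.mpr hgd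
    refine (hc.tendsto.mono_left nhdsWithin_le_nhds).congr' ?_
    filter_upwards [self_mem_nhdsWithin, nhdsWithin_le_nhds (isOpen_ne.mem_nhds hb)] with x hx hx0
    exact (key x hx0 hx).symm
  · exact key b hb fun h => hab (by rw [h, add_neg_cancel])

/-- `g` is holomorphic away from 0, hence so is its `dslope`, including at the base point. -/
theorem differentiableAt_SNQC (hp : p ≠ 0) (hq : q ≠ 0) {n m : ℤ}
    (hf : fCas p q c Ap Am n m ≠ 0) {a : ℂ} (ha : a ≠ 0) :
    DifferentiableAt ℂ (fun b => SNQC p q c Ap Am a b n m) (-a) := by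
  refine DifferentiableAt.congr_of_eventuallyEq ?_ (SNQC_eventuallyEq hp hq hf ha)
  have hmem : {b : ℂ | b ≠ 0} ∈ 𝓝 (-a) := isOpen_ne.mem_nhds (neg_ne_zero.mpr ha)
  refine ((Complex.differentiableOn_dslope hmem).mpr fun b hb => ?_).differentiableAt hmem
  exact (((differentiableAt_evenDet_normFactor N _ hb).div_const _).neg).differentiableWithinAt

theorem SNQC_neg (hp : p ≠ 0) (hq : q ≠ 0) {n m : ℤ} (hf : fCas p q c Ap Am n m ≠ 0)
    {a : ℂ} (ha : a ≠ 0) :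
    SNQC p q c Ap Am (-a) a n m = -(evenDetDeriv N (waveSeries p q c 1 1 0 0 n m) a /
      evenDet N (waveSeries p q c 1 1 0 0 n m)) := by
  have := (SNQC_eventuallyEq hp hq hf (neg_ne_zero.mpr ha)).self_of_nhds
  simp only [neg_neg, dslope_same] at this
  rw [this]
  exact (((hasDerivAt_evenDet N (waveSeries p q c 1 1 0 0 n m) ha).div_const _).neg).deriv

theorem rho_neg (p q a : ℂ) (n m : ℤ) : rho p q (-a) n m = (rho p q a n m)⁻¹ := by
  simp only [rho, mul_inv, ← inv_zpow, inv_div, sub_neg_eq_add, ← sub_eq_add_neg]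

theorem uQ1_eq_uSeries (hp : p ≠ 0) (hq : q ≠ 0) {n m : ℤ} (hf : fCas p q c Ap Am n m ≠ 0)
    {a : ℂ} (ha : a ≠ 0) (A B D ξ₀ : ℂ) :
    uQ1 p q c Ap Am a A B D ξ₀ n m =
      uSeries N a A B D (xi p q a n m + ξ₀) (rho p q a n m) (waveSeries p q c 1 1 0 0 n m) := by
  have h1 := SNQC_self hp hq hf ha
  have h2 := SNQC_self hp hq hf (neg_ne_zero.mpr ha)
  rw [neg_neg] at h2
  rw [uQ1, uSeries, ← h1, ← h2, SNQC_neg hp hq hf ha, rho_neg]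
  ring

end

end RationalABS

/-! ### The lattice equation and the degeneration -/

theorem mainTheorem6 (N : ℕ) (p q a c : ℂ)
    (hp : p ≠ 0) (hq : q ≠ 0) (ha : a ≠ 0) (hc : c ≠ 0)
    (hpa : p ^ 2 ≠ a ^ 2) (hqa : q ^ 2 ≠ a ^ 2)
    (Ap Am : Matrix (Fin N) (Fin N) ℂ)
    (hAp : RationalABS.IsLowerToeplitz Ap) (hAp' : IsUnit Ap.det)
    (hAm : RationalABS.IsLowerToeplitz Am) (hAm' : IsUnit Am.det)
    (A B D ξ₀ δ : ℂ) (hABD : A * D + 1 / 4 * B ^ 2 = δ ^ 2 / 16) :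
    (∀ n m : ℤ,
      RationalABS.fCas p q c Ap Am n m ≠ 0 →
      RationalABS.fCas p q c Ap Am (n + 1) m ≠ 0 →
      RationalABS.fCas p q c Ap Am n (m + 1) ≠ 0 →
      RationalABS.fCas p q c Ap Am (n + 1) (m + 1) ≠ 0 →
      RationalABS.Q1At p q a δ (RationalABS.uQ1 p q c Ap Am a A B D ξ₀) n m) ∧
    (∀ n m : ℤ, RationalABS.fCas p q c Ap Am n m ≠ 0 →
      DifferentiableAt ℂ (fun b : ℂ => RationalABS.SNQC p q c Ap Am a b n m) (-a) ∧
      DifferentiableAt ℂ (fun b : ℂ => RationalABS.SNQC p q c Ap Am (-a) b n m) a ∧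
      Tendsto
        (fun ε : ℂ => ε * (RationalABS.uQ2 p q c Ap Am a (2 * A / ε) (2 * D / ε)
            (ξ₀ + 2 * B / ε) n m - δ ^ 2 / (4 * ε ^ 2)))
        (𝓝[≠] 0) (𝓝 (RationalABS.uQ1 p q c Ap Am a A B D ξ₀ n m))) := by
  refine ⟨fun n m f0 f1 f2 f3 => ?_, fun n m f0 => ⟨?_, ?_, ?_⟩⟩
  · have hp₁ : p + a ≠ 0 := fun h => hpa (by linear_combination (p - a) * h)
    have hp₂ : p - a ≠ 0 := fun h => hpa (by linear_combination (p + a) * h)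
    have hq₁ : q + a ≠ 0 := fun h => hqa (by linear_combination (q - a) * h)
    have hq₂ : q - a ≠ 0 := fun h => hqa (by linear_combination (q + a) * h)
    have hp₃ : a ^ 2 - p ^ 2 ≠ 0 := sub_ne_zero.mpr hpa.symm
    have hq₃ : a ^ 2 - q ^ 2 ≠ 0 := sub_ne_zero.mpr hqa.symm
    have hP := div_ne_zero hp₁ hp₂
    have hQ := div_ne_zero hq₁ hq₂
    have ep : (p + a) * (p - a) = -(a ^ 2 - p ^ 2) := by ring
    have eq : (q + a) * (q - a) = -(a ^ 2 - q ^ 2) := by ring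
    have ne : ∀ {n m : ℤ}, RationalABS.fCas p q c Ap Am n m ≠ 0 →
        RationalABS.evenDet N (RationalABS.waveSeries p q c 1 1 0 0 n m) ≠ 0 := by
      intro n m hf
      rw [RationalABS.fCas_eq_evenDet hp hq] at hf
      exact right_ne_zero_of_mul hf
    refine RationalABS.uSeries_Q1 N (RationalABS.xi p q a n m + ξ₀)
      (RationalABS.waveSeries_add_one_left hp hq n m)
      (RationalABS.waveSeries_add_one_right hp hq n m)
      (RationalABS.waveSeries_add_one_right hp hq (n + 1) m) ha hp₁ hp₂ hq₁ hq₂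
      (r := RationalABS.rho p q a n m)
      (mul_ne_zero (zpow_ne_zero _ hP) (zpow_ne_zero _ hQ)) hABD (ne f0) (ne f1) (ne f2) (ne f3)
      (RationalABS.uQ1_eq_uSeries hp hq f0 ha A B D ξ₀) ?_ ?_ ?_
    · rw [RationalABS.uQ1_eq_uSeries hp hq f1 ha A B D ξ₀]
      congr 1
      · simp only [RationalABS.xi, ep]
        push_cast
        field_simp
        ring
      · simp only [RationalABS.rho, zpow_add_one₀ hP]
        ring
    · rw [RationalABS.uQ1_eq_uSeries hp hq f2 ha A B D ξ₀]
      congr 1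
      · simp only [RationalABS.xi, eq]
        push_cast
        field_simp
        ring
      · simp only [RationalABS.rho, zpow_add_one₀ hQ]
        ring
    · rw [RationalABS.uQ1_eq_uSeries hp hq f3 ha A B D ξ₀]
      congr 1
      · simp only [RationalABS.xi, ep, eq]
        push_cast
        field_simp
        ring
      · simp only [RationalABS.rho, zpow_add_one₀ hP, zpow_add_one₀ hQ]
        ring
  · exact RationalABS.differentiableAt_SNQC hp hq f0 ha
  · simpa using RationalABS.differentiableAt_SNQC hp hq f0 (neg_ne_zero.mpr ha)
  -- For ε ≠ 0 the expression equals ε K + u exactly: the terms in 1/ε sum to 4AD + B² - δ²/4 = 0.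
  -- The derivatives U enter only through `K`, which the limit removes.
  · set K := 1 / 4 * ((RationalABS.xi p q a n m + ξ₀) ^ 2 + 1) +
      a * (RationalABS.xi p q a n m + ξ₀) * RationalABS.SNQC p q c Ap Am (-a) a n m +
      a ^ 2 * (RationalABS.UUleft p q c Ap Am a n m + RationalABS.UUright p q c Ap Am a n m)
      with hK
    have hlim : Tendsto (fun ε : ℂ => ε * K + RationalABS.uQ1 p q c Ap Am a A B D ξ₀ n m)
        (𝓝[≠] 0) (𝓝 (RationalABS.uQ1 p q c Ap Am a A B D ξ₀ n m)) := by
      have h : Continuous fun ε : ℂ =>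
        ε * K + RationalABS.uQ1 p q c Ap Am a A B D ξ₀ n m := by fun_prop
      simpa using (h.tendsto 0).mono_left (nhdsWithin_le_nhds (s := {0}ᶜ))
    refine hlim.congr' ?_
    filter_upwards [self_mem_nhdsWithin] with ε hε
    have hε : ε ≠ 0 := hε
    have hδ : δ ^ 2 = 16 * (A * D) + 4 * B ^ 2 := by linear_combination -16 * hABD
    rw [RationalABS.uQ2, RationalABS.uQ1, hδ, hK]
    field_simp
    ring
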